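/- \textbf{Proposition (permutationally invariant MaxLik--MaxEnt principle).} Let $N\ge 0$, and for $p\in S_N$ let $V(p)$ be the unitary on $(\mathbb C^2)^{\otimes N}$ with $V(p)|i_1,\dots,i_N\rangle=|i_{p^{-1}(1)},\dots,i_{p^{-1}(N)}\rangle$. A state is a density operator on $(\mathbb C^2)^{\otimes N}$; it is permutationally invariant (PI) if $V(p)\rho V(p)^\dagger=\rho$ for all $p\in S_N$. Write $[A]_{\rm PI}=\frac1{N!}\sum_{p\in S_N}V(p)AV(p)^\dagger$. Let $(\hat a)_{a\in I}$ be a finite family of unit vectors in $\mathbb R^3$, let $|0\rangle_a,|1\rangle_a$ be the eigenvectors of $\hat a\cdot\vec\sigma$ for the eigenvalues $+1,-1$, and let $$M_k^a=\binom Nk\Big[\,|0\rangle_a\langle 0|^{\otimes k}\otimes|1\rangle_a\langle 1|^{\otimes (N-k)}\Big]_{\rm PI},\qquad p_k^a(\rho)=\mathrm{tr}(\rho M_k^a),\qquad k=0,\dots,N .$$ Assume that the settings are tomographically complete for PI states: two PI states with the same probabilities $p_k^a$ for all $a,k$ are equal. Let $f_k^a\ge 0$ be the observed frequencies (no normalization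 is needed) and let $$F(\rho)=-\sum_{a,k}f_k^a\log p_k^a(\rho)\in(-\infty,+\infty],\qquad 0\log 0=0,\quad -f\log 0=+\infty\ \text{ for } f>0 .$$ A \emph{PI maximum-likelihood reconstruction} is a PI state minimizing $F$ among all PI states. A \emph{maximum-likelihood state} is a state minimizing $F$ among all states. A \emph{MaxLik--MaxEnt solution} is a maximum-likelihood state whose von Neumann entropy $S(\rho)=-\mathrm{tr}(\rho\log\rho)$ is largest among all maximum-likelihood states. Then: (i) A PI maximum-likelihood reconstruction exists, and there is exactly one MaxLik--MaxEnt solution. (ii) Every PI maximum-likelihood reconstruction is a maximum-likelihood state. (iii) If the PI maximum-likelihood reconstruction $\hat\rho_{\rm PI}$ is unique, then it coincides with the MaxLik--MaxEnt solution: among all maximum-likelihood states it is the one of largest von Neumann entropy. (iv) The PI maximum-likelihood reconstruction is unique whenever the probabilities $p_k^a$ of the observed outcomes (those with $f_k^a>0$) already determine every PI state; in particular whenever all $f_k^a>0$. (v) In general, a state is the MaxLik--MaxEnt solution if and only if it is a PI maximum-likelihood reconstruction and has the largest von Neumann entropy among all PI maximum-likelihood reconstructions. -/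

import Mathlib

open scoped BigOperators ComplexOrder

noncomputable section

namespace PITomography

/-- Computational basis labels of `N` qubits. -/
abbrev QubitIdx (N : ℕ) : Type := Fin N → Fin 2

/-- Operators on the `N`-qubit Hilbert space `(ℂ²)^{⊗N}`, as matrices in the computational basis. -/
abbrev Op (N : ℕ) : Type := Matrix (QubitIdx N) (QubitIdx N) ℂ

/-- The tensor product `A 0 ⊗ A 1 ⊗ ⋯ ⊗ A (N-1)` of single-qubit operators. -/
def tensorOp {N : ℕ} (A : Fin N → Matrix (Fin 2) (Fin 2) ℂ) : Op N :=
  Matrix.of fun x y => ∏ n, A n (x n) (y n)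

/-- The permutation unitary `V(p) |i_1, …, i_N⟩ = |i_{p⁻¹(1)}, …, i_{p⁻¹(N)}⟩`. -/
def permOp {N : ℕ} (p : Equiv.Perm (Fin N)) : Op N :=
  Matrix.of fun x y => if x = (fun n => y (p⁻¹ n)) then 1 else 0

/-- The permutationally invariant part `[A]_PI = (1/N!) ∑_p V(p) A V(p)†`. -/
def piPart {N : ℕ} (A : Op N) : Op N :=
  ((N.factorial : ℂ)⁻¹) • ∑ p : Equiv.Perm (Fin N), permOp p * A * (permOp p).conjTranspose

/-- `A` is invariant under all interchanges of the particles. -/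
def IsPermInvariant {N : ℕ} (A : Op N) : Prop :=
  ∀ p : Equiv.Perm (Fin N), permOp p * A * (permOp p).conjTranspose = A

/-- Density operators: positive semidefinite with unit trace. -/
def IsDensity {N : ℕ} (ρ : Op N) : Prop :=
  ρ.PosSemidef ∧ ρ.trace = 1

/-- The observable `a · σ = a_x σ_x + a_y σ_y + a_z σ_z`. -/
def pauliDot (a : EuclideanSpace ℝ (Fin 3)) : Matrix (Fin 2) (Fin 2) ℂ :=
  (a 0 : ℂ) • !![0, 1; 1, 0] + (a 1 : ℂ) • !![0, -Complex.I; Complex.I, 0]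
    + (a 2 : ℂ) • !![1, 0; 0, -1]

/-- The projectors `|0⟩_a⟨0| = (1 + a·σ)/2` and `|1⟩_a⟨1| = (1 - a·σ)/2` onto the eigenvectors of
`a · σ` with eigenvalues `+1` and `-1` (for a unit vector `a`). -/
def eigenProj (a : EuclideanSpace ℝ (Fin 3)) (b : Fin 2) : Matrix (Fin 2) (Fin 2) ℂ :=
  (2 : ℂ)⁻¹ • (1 + ((-1 : ℂ) ^ (b : ℕ)) • pauliDot a)

/-- The coarse-grained measurement operator
`M_k^a = (N choose k) [ |0⟩_a⟨0|^{⊗k} ⊗ |1⟩_a⟨1|^{⊗(N-k)} ]_PI`: exactly `k` of the `N` parties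
obtain outcome `0` when all of them measure in the eigenbasis of `a · σ`. -/
def measOp (N : ℕ) (a : EuclideanSpace ℝ (Fin 3)) (k : Fin (N + 1)) : Op N :=
  (N.choose k : ℂ) •
    piPart (tensorOp fun n : Fin N => if (n : ℕ) < (k : ℕ) then eigenProj a 0 else eigenProj a 1)

/-- The probability `p_k^a(ρ) = tr(ρ M_k^a)`. -/
def prob {N : ℕ} (a : EuclideanSpace ℝ (Fin 3)) (k : Fin (N + 1)) (ρ : Op N) : ℝ :=
  (ρ * measOp N a k).trace.re

/-- The maximum-likelihood fit function `F(ρ) = -∑_{a,k} f_k^a log p_k^a(ρ)`, with values in the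
extended reals: `0 * log 0 = 0`, and `-f log 0 = +∞` for `f > 0`. -/
def fitML {N : ℕ} {ι : Type*} [Fintype ι] (a : ι → EuclideanSpace ℝ (Fin 3))
    (f : ι → Fin (N + 1) → ℝ) (ρ : Op N) : EReal :=
  ∑ i, ∑ k, -((f i k : EReal) * ENNReal.log (ENNReal.ofReal (prob (a i) k ρ)))

/-- The probabilities of the (setting, outcome) pairs in `O` determine every permutationally
invariant state. -/
def TomographicallyComplete {N : ℕ} {ι : Type*} (a : ι → EuclideanSpace ℝ (Fin 3))
    (O : Set (ι × Fin (N + 1))) : Prop :=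
  ∀ ρ σ : Op N, IsDensity ρ → IsPermInvariant ρ → IsDensity σ → IsPermInvariant σ →
    (∀ x ∈ O, prob (a x.1) x.2 ρ = prob (a x.1) x.2 σ) → ρ = σ

/-- `ρ` is a result of the permutationally invariant maximum-likelihood reconstruction: it minimizes
the fit function among all permutationally invariant states. -/
def IsPIReconstruction {N : ℕ} {ι : Type*} [Fintype ι] (a : ι → EuclideanSpace ℝ (Fin 3))
    (f : ι → Fin (N + 1) → ℝ) (ρ : Op N) : Prop :=
  IsDensity ρ ∧ IsPermInvariant ρ ∧
    ∀ σ : Op N, IsDensity σ → IsPermInvariant σ → fitML a f ρ ≤ fitML a f σ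

/-- `ρ` is a maximum-likelihood state: it minimizes the fit function among all states. -/
def IsMaxLik {N : ℕ} {ι : Type*} [Fintype ι] (a : ι → EuclideanSpace ℝ (Fin 3))
    (f : ι → Fin (N + 1) → ℝ) (ρ : Op N) : Prop :=
  IsDensity ρ ∧ ∀ σ : Op N, IsDensity σ → fitML a f ρ ≤ fitML a f σ

/-- The von Neumann entropy `S(ρ) = -tr(ρ log ρ)`, as the trace of `η(ρ)` with
`η(x) = -x log x`, `η(0) = 0`. -/
def vonNeumannEntropy {N : ℕ} (ρ : Op N) : ℝ :=
  (cfc Real.negMulLog ρ).trace.re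

/-- `ρ` solves the maximum-likelihood maximum-entropy principle: among all maximum-likelihood
states it has the largest von Neumann entropy. -/
def IsMaxLikMaxEnt {N : ℕ} {ι : Type*} [Fintype ι] (a : ι → EuclideanSpace ℝ (Fin 3))
    (f : ι → Fin (N + 1) → ℝ) (ρ : Op N) : Prop :=
  IsMaxLik a f ρ ∧ ∀ σ : Op N, IsMaxLik a f σ → vonNeumannEntropy σ ≤ vonNeumannEntropy ρ

end PITomography

end

/-! Two convexity facts and one symmetry carry the proof. The fit function depends on a state only
through the probabilities, which are unchanged under permutations and under averaging over them. So
the average of any state is a permutationally invariant competitor with the same fit, and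
reconstructions are global minimizers (`IsPIReconstruction.isMaxLik`).

The likelihood is strictly log-concave in the observed probabilities, so all maximum-likelihood
states agree on them (`IsMaxLik.prob_eq`). These states therefore form a compact set closed under
midpoints. Entropy is upper semicontinuous and strictly concave, hence has exactly one maximizer
there (`exists_isMaxLikMaxEnt`, `IsMaxLikMaxEnt.eq`). Permuting the maximizer gives another one, so
it is invariant and is itself a reconstruction. The remaining claims follow by comparison with it.
-/

noncomputable section

namespace PITomography

open Matrix

/-! ### Compactness of density matrices; entropy as a minimum over bases -/

section Entropy

variable {n : Type*}

lemma posSemidef_midpoint {A B : Matrix n n ℂ} (hA : A.PosSemidef) (hB : B.PosSemidef) :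
    ((2 : ℂ)⁻¹ • (A + B)).PosSemidef :=
  (hA.add hB).smul (by simp)

variable [Fintype n]

open scoped MatrixOrder Matrix.Norms.L2Operator in
lemma _root_.Matrix.PosSemidef.exists_eq_conjTranspose_mul_self {A : Matrix n n ℂ}
    (hA : A.PosSemidef) : ∃ B : Matrix n n ℂ, A = Bᴴ * B := by
  classical
  exact CStarAlgebra.nonneg_iff_eq_star_mul_self.mp hA.nonneg

/-- The Shannon entropy of the diagonal of `A` in the basis given by the columns of `U`. -/
def diagEntropy (U A : Matrix n n ℂ) : ℝ :=
  ∑ i, Real.negMulLog ((Uᴴ * A * U) i i).re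

lemma continuous_diagEntropy (U : Matrix n n ℂ) : Continuous (diagEntropy U) := by
  unfold diagEntropy
  refine continuous_finsetSum _ fun i _ => Real.continuous_negMulLog.comp ?_
  refine Complex.continuous_re.comp ?_
  have h : Continuous fun A : Matrix n n ℂ => Uᴴ * A * U := by fun_prop
  exact h.matrix_elem i i

/-- Density matrices form a compact set. -/
lemma isCompact_density : IsCompact {A : Matrix n n ℂ | A.PosSemidef ∧ A.trace = 1} := by
  -- Density matrices are the `Bᴴ * B` with squared entries of `B` summing to 1, so the factors lie
  -- in a compact box.
  let K : Set (Matrix n n ℂ) :=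
    (Set.univ.pi fun _ => Set.univ.pi fun _ => Metric.closedBall (0 : ℂ) 1) ∩
      {B | (Bᴴ * B).trace = 1}
  have hK : IsCompact K := by
    refine IsCompact.inter_right ?_ ?_
    · exact isCompact_univ_pi fun _ => isCompact_univ_pi fun _ => isCompact_closedBall _ _
    · exact isClosed_eq (by fun_prop) continuous_const
  have himg : {A : Matrix n n ℂ | A.PosSemidef ∧ A.trace = 1} =
      (fun B : Matrix n n ℂ => Bᴴ * B) '' K := by
    ext A
    constructor
    · rintro ⟨hA, hA1⟩
      obtain ⟨B, rfl⟩ := hA.exists_eq_conjTranspose_mul_self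
      refine ⟨B, ⟨fun i _ j _ => ?_, hA1⟩, rfl⟩
      have h1 : ∑ j, ∑ i, Complex.normSq (B i j) = 1 := by
        have : ((∑ j, ∑ i, Complex.normSq (B i j) : ℝ) : ℂ) = 1 := by
          rw [← hA1, trace]
          push_cast
          refine Finset.sum_congr rfl fun j _ => ?_
          rw [diag_apply, mul_apply]
          exact Finset.sum_congr rfl fun i _ => by
            simp [Complex.normSq_eq_conj_mul_self]
        exact_mod_cast this
      have h2 : Complex.normSq (B i j) ≤ 1 := by
        rw [← h1]
        refine (Finset.single_le_sum (f := fun i => Complex.normSq (B i j))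
          (fun _ _ => Complex.normSq_nonneg _) (Finset.mem_univ i)).trans ?_
        exact Finset.single_le_sum (f := fun j => ∑ i, Complex.normSq (B i j))
          (fun _ _ => Finset.sum_nonneg fun _ _ => Complex.normSq_nonneg _) (Finset.mem_univ j)
      rw [mem_closedBall_zero_iff]
      rw [Complex.normSq_eq_norm_sq] at h2
      exact (sq_le_one_iff₀ (norm_nonneg _)).mp h2
    · rintro ⟨B, ⟨-, hB⟩, rfl⟩
      exact ⟨posSemidef_conjTranspose_mul_self B, hB⟩
  rw [himg]
  exact hK.image (by fun_prop)

variable [DecidableEq n]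

lemma sum_normSq_row {W : Matrix n n ℂ} (hW : W ∈ unitaryGroup n ℂ) (i : n) :
    ∑ j, Complex.normSq (W i j) = 1 := by
  have h := congrFun (congrFun (mem_unitaryGroup_iff.mp hW) i) i
  rw [mul_apply] at h
  have h' : ((∑ j, Complex.normSq (W i j) : ℝ) : ℂ) = 1 := by
    rw [one_apply_eq] at h
    rw [← h]
    push_cast
    exact Finset.sum_congr rfl fun j _ => by simp [star_apply, Complex.mul_conj]
  exact_mod_cast h'

lemma sum_normSq_col {W : Matrix n n ℂ} (hW : W ∈ unitaryGroup n ℂ) (j : n) :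
    ∑ i, Complex.normSq (W i j) = 1 := by
  have h := congrFun (congrFun (mem_unitaryGroup_iff'.mp hW) j) j
  rw [mul_apply] at h
  have h' : ((∑ i, Complex.normSq (W i j) : ℝ) : ℂ) = 1 := by
    rw [one_apply_eq] at h
    rw [← h]
    push_cast
    exact Finset.sum_congr rfl fun i _ => by simp [star_apply, Complex.normSq_eq_conj_mul_self]
  exact_mod_cast h'

lemma conj_diagonal_apply (W : Matrix n n ℂ) (l : n → ℝ) (i k : n) :
    (W * diagonal (fun j => (l j : ℂ)) * Wᴴ) i k = ∑ j, W i j * l j * star (W k j) := by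
  rw [mul_apply]
  exact Finset.sum_congr rfl fun j _ => by rw [mul_diagonal, conjTranspose_apply]

lemma conj_diagonal_apply_self_re (W : Matrix n n ℂ) (l : n → ℝ) (i : n) :
    ((W * diagonal (fun j => (l j : ℂ)) * Wᴴ) i i).re = ∑ j, Complex.normSq (W i j) • l j := by
  rw [conj_diagonal_apply, Complex.re_sum]
  refine Finset.sum_congr rfl fun j _ => ?_
  simp [Complex.normSq_apply]
  ring

/-- The weights `|W i j|²` are doubly stochastic, so this is Jensen's inequality row by row, with
column sums restoring the left side. Equality makes `l` constant on the support of each row, and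
orthogonality of the rows then kills the off-diagonal entries. -/
lemma sum_negMulLog_le_conj_diagonal {W : Matrix n n ℂ} (hW : W ∈ unitaryGroup n ℂ) {l : n → ℝ}
    (hl : ∀ j, 0 ≤ l j) :
    ∑ j, Real.negMulLog (l j) ≤
      ∑ i, Real.negMulLog ((W * diagonal (fun j => (l j : ℂ)) * Wᴴ) i i).re ∧
    (∑ j, Real.negMulLog (l j) =
      ∑ i, Real.negMulLog ((W * diagonal (fun j => (l j : ℂ)) * Wᴴ) i i).re →
      W * diagonal (fun j => (l j : ℂ)) * Wᴴ =
        diagonal fun i => (((W * diagonal (fun j => (l j : ℂ)) * Wᴴ) i i).re : ℂ)) := by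
  have hsum : ∑ j, Real.negMulLog (l j) =
      ∑ i, ∑ j, Complex.normSq (W i j) • Real.negMulLog (l j) := by
    rw [Finset.sum_comm]
    refine Finset.sum_congr rfl fun j _ => ?_
    rw [← Finset.sum_smul, sum_normSq_col hW, one_smul]
  have hle : ∀ i ∈ Finset.univ, ∑ j, Complex.normSq (W i j) • Real.negMulLog (l j) ≤
      Real.negMulLog (∑ j, Complex.normSq (W i j) • l j) := fun i _ =>
    Real.concaveOn_negMulLog.le_map_sum (fun j _ => Complex.normSq_nonneg _) (sum_normSq_row hW i)
      fun j _ => hl j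
  simp_rw [conj_diagonal_apply_self_re, hsum]
  refine ⟨Finset.sum_le_sum hle, fun heq => ?_⟩
  rw [Finset.sum_eq_sum_iff_of_le hle] at heq
  -- The factor `W i j` lets the equality case of Jensen be stated also where the weight vanishes.
  have key : ∀ i j, W i j * l j = W i j * ((∑ j, Complex.normSq (W i j) • l j : ℝ) : ℂ) := by
    intro i j
    by_cases hz : W i j = 0
    · simp [hz]
    · have := (Real.strictConcaveOn_negMulLog.map_sum_eq_iff'
        (fun j _ => Complex.normSq_nonneg (W i j)) (sum_normSq_row hW i)
        (fun j _ => hl j)).mp (heq i (Finset.mem_univ i)).symm j (Finset.mem_univ j)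
        (by simpa using hz)
      rw [← this]
  ext i k
  rw [conj_diagonal_apply]
  simp_rw [key]
  have hone := congrFun (congrFun (mem_unitaryGroup_iff.mp hW) i) k
  rw [mul_apply] at hone
  simp_rw [star_apply] at hone
  have : ∑ j, W i j * ((∑ j, Complex.normSq (W i j) • l j : ℝ) : ℂ) * star (W k j) =
      ((∑ j, Complex.normSq (W i j) • l j : ℝ) : ℂ) * ∑ j, W i j * star (W k j) := by
    rw [Finset.mul_sum]
    exact Finset.sum_congr rfl fun j _ => by ring
  rw [this, hone, diagonal_apply, one_apply]
  split_ifs <;> simp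

lemma _root_.Matrix.IsHermitian.eq_eigenvector_conj {A : Matrix n n ℂ} (hA : A.IsHermitian) :
    A = hA.eigenvectorUnitary.1 * diagonal (fun j => (hA.eigenvalues j : ℂ)) *
      hA.eigenvectorUnitary.1ᴴ := by
  conv_lhs => rw [hA.spectral_theorem, Unitary.conjStarAlgAut_apply]
  rfl

lemma trace_cfc_eq_sum {A : Matrix n n ℂ} (hA : A.IsHermitian) (g : ℝ → ℝ) :
    (cfc g A).trace.re = ∑ i, g (hA.eigenvalues i) := by
  rw [hA.cfc_eq, IsHermitian.cfc, Unitary.conjStarAlgAut_apply, trace_mul_comm, ← mul_assoc,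
    Unitary.coe_star_mul_self, one_mul, trace_diagonal]
  simp

/-- Together with `exists_trace_cfc_eq_diagEntropy`, this is the variational formula for entropy:
the minimum over orthonormal bases of the Shannon entropy of the diagonal, attained only in
eigenbases. Unitary invariance, upper semicontinuity and strict concavity are all read off from it.
-/
lemma trace_cfc_le_diagEntropy {A U : Matrix n n ℂ} (hA : A.PosSemidef)
    (hU : U ∈ unitaryGroup n ℂ) :
    (cfc Real.negMulLog A).trace.re ≤ diagEntropy U A ∧
      ((cfc Real.negMulLog A).trace.re = diagEntropy U A →
        Uᴴ * A * U = diagonal fun i => (((Uᴴ * A * U) i i).re : ℂ)) := by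
  have hW : Uᴴ * hA.1.eigenvectorUnitary.1 ∈ unitaryGroup n ℂ :=
    mul_mem (Unitary.star_mem hU) hA.1.eigenvectorUnitary.2
  have hE : Uᴴ * A * U = Uᴴ * hA.1.eigenvectorUnitary.1 *
      diagonal (fun j => (hA.1.eigenvalues j : ℂ)) * (Uᴴ * hA.1.eigenvectorUnitary.1)ᴴ := by
    conv_lhs => rw [hA.1.eq_eigenvector_conj]
    simp only [conjTranspose_mul, conjTranspose_conjTranspose, mul_assoc]
  rw [trace_cfc_eq_sum hA.1, diagEntropy, hE]
  exact sum_negMulLog_le_conj_diagonal hW hA.eigenvalues_nonneg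

lemma exists_trace_cfc_eq_diagEntropy {A : Matrix n n ℂ} (hA : A.IsHermitian) :
    ∃ U ∈ unitaryGroup n ℂ, (cfc Real.negMulLog A).trace.re = diagEntropy U A := by
  refine ⟨_, hA.eigenvectorUnitary.2, ?_⟩
  have hU : hA.eigenvectorUnitary.1ᴴ * hA.eigenvectorUnitary.1 = 1 :=
    mem_unitaryGroup_iff'.mp hA.eigenvectorUnitary.2
  have h : hA.eigenvectorUnitary.1ᴴ * A * hA.eigenvectorUnitary.1 =
      diagonal fun j => (hA.eigenvalues j : ℂ) := by
    conv_lhs =>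
      enter [1, 2]
      rw [hA.eq_eigenvector_conj]
    calc _ = (hA.eigenvectorUnitary.1ᴴ * hA.eigenvectorUnitary.1) *
          diagonal (fun j => (hA.eigenvalues j : ℂ)) *
          (hA.eigenvectorUnitary.1ᴴ * hA.eigenvectorUnitary.1) := by simp only [mul_assoc]
      _ = _ := by rw [hU, one_mul, mul_one]
  rw [trace_cfc_eq_sum hA, diagEntropy, h]
  simp

lemma trace_cfc_conj_le {A U : Matrix n n ℂ} (hA : A.PosSemidef) (hU : U ∈ unitaryGroup n ℂ) :
    (cfc Real.negMulLog (U * A * Uᴴ)).trace.re ≤ (cfc Real.negMulLog A).trace.re := by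
  obtain ⟨E, hE, h⟩ := exists_trace_cfc_eq_diagEntropy hA.1
  have hU' : Uᴴ * U = 1 := mem_unitaryGroup_iff'.mp hU
  refine (trace_cfc_le_diagEntropy (hA.mul_mul_conjTranspose_same U) (mul_mem hU hE)).1.trans_eq ?_
  have : (U * E)ᴴ * (U * A * Uᴴ) * (U * E) = Eᴴ * A * E := by
    calc _ = Eᴴ * (Uᴴ * U) * A * (Uᴴ * U) * E := by
          simp only [conjTranspose_mul, mul_assoc]
      _ = _ := by rw [hU', mul_one, mul_one]
  rw [h, diagEntropy, diagEntropy, this]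

lemma trace_cfc_conj {A U : Matrix n n ℂ} (hA : A.PosSemidef) (hU : U ∈ unitaryGroup n ℂ) :
    (cfc Real.negMulLog (U * A * Uᴴ)).trace.re = (cfc Real.negMulLog A).trace.re := by
  refine (trace_cfc_conj_le hA hU).antisymm ?_
  have h := trace_cfc_conj_le (hA.mul_mul_conjTranspose_same U) (Unitary.star_mem hU)
  have hU' : Uᴴ * U = 1 := mem_unitaryGroup_iff'.mp hU
  have : Uᴴ * (U * A * Uᴴ) * Uᴴᴴ = A := by
    calc _ = (Uᴴ * U) * A * (Uᴴ * U) := by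
          simp only [conjTranspose_conjTranspose, mul_assoc]
      _ = _ := by rw [hU', one_mul, mul_one]
  rwa [star_eq_conjTranspose, this] at h

/-- An infimum of continuous functions is upper semicontinuous; the eigenbasis at `A` serves as test
basis nearby. -/
lemma upperSemicontinuousOn_trace_cfc :
    UpperSemicontinuousOn (fun A : Matrix n n ℂ => (cfc Real.negMulLog A).trace.re)
      {A | A.PosSemidef} := by
  intro A hA y hy
  obtain ⟨U, hU, h⟩ := exists_trace_cfc_eq_diagEntropy (Matrix.PosSemidef.isHermitian hA)
  have hy' : diagEntropy U A < y := h ▸ hy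
  have hcont : ContinuousWithinAt (diagEntropy U) {A | A.PosSemidef} A :=
    (continuous_diagEntropy U).continuousWithinAt
  have := hcont.eventually_lt_const hy'
  filter_upwards [this, self_mem_nhdsWithin] with B hB hB'
  exact (trace_cfc_le_diagEntropy hB' hU).1.trans_lt hB

/-- Both matrices are tested in an eigenbasis of the midpoint. If their diagonals differ, strict
concavity of `Real.negMulLog` gives the gap. If the diagonals agree, equality would make both
matrices diagonal in that basis, hence equal. -/
lemma trace_cfc_midpoint_lt {A B : Matrix n n ℂ} (hA : A.PosSemidef) (hB : B.PosSemidef)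
    (hne : A ≠ B) :
    ((cfc Real.negMulLog A).trace.re + (cfc Real.negMulLog B).trace.re) / 2 <
      (cfc Real.negMulLog ((2 : ℂ)⁻¹ • (A + B))).trace.re := by
  obtain ⟨U, hU, h⟩ := exists_trace_cfc_eq_diagEntropy (posSemidef_midpoint hA hB).1
  have hU' : U * Uᴴ = 1 := mem_unitaryGroup_iff.mp hU
  rw [h]
  obtain ⟨hA1, hA2⟩ := trace_cfc_le_diagEntropy hA hU
  obtain ⟨hB1, hB2⟩ := trace_cfc_le_diagEntropy hB hU
  have hdiag : diagEntropy U ((2 : ℂ)⁻¹ • (A + B)) =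
      ∑ i, Real.negMulLog ((1 / 2 : ℝ) • ((Uᴴ * A * U) i i).re +
        (1 / 2 : ℝ) • ((Uᴴ * B * U) i i).re) := by
    refine Finset.sum_congr rfl fun i _ => ?_
    congr 1
    rw [Matrix.mul_smul, Matrix.smul_mul, mul_add, add_mul, Matrix.smul_apply, Matrix.add_apply, smul_eq_mul]
    have : (2 : ℂ)⁻¹ = ((1 / 2 : ℝ) : ℂ) := by norm_num
    rw [this, Complex.re_ofReal_mul, Complex.add_re, smul_eq_mul, smul_eq_mul, mul_add]
  have hnn : ∀ {C : Matrix n n ℂ}, C.PosSemidef → ∀ i, 0 ≤ ((Uᴴ * C * U) i i).re := fun hC i =>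
    (Complex.nonneg_iff.mp (hC.conjTranspose_mul_mul_same U).diag_nonneg).1
  have hterm : ∀ i ∈ Finset.univ,
      (1 / 2 : ℝ) • Real.negMulLog ((Uᴴ * A * U) i i).re +
        (1 / 2 : ℝ) • Real.negMulLog ((Uᴴ * B * U) i i).re ≤
      Real.negMulLog ((1 / 2 : ℝ) • ((Uᴴ * A * U) i i).re +
        (1 / 2 : ℝ) • ((Uᴴ * B * U) i i).re) := fun i _ =>
    Real.concaveOn_negMulLog.2 (hnn hA i) (hnn hB i) (by norm_num) (by norm_num) (by norm_num)
  have hsplit : ∑ i, ((1 / 2 : ℝ) • Real.negMulLog ((Uᴴ * A * U) i i).re +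
        (1 / 2 : ℝ) • Real.negMulLog ((Uᴴ * B * U) i i).re) =
      (diagEntropy U A + diagEntropy U B) / 2 := by
    rw [Finset.sum_add_distrib, ← Finset.smul_sum, ← Finset.smul_sum, diagEntropy, diagEntropy]
    simp only [smul_eq_mul]
    ring
  by_cases heq : ∀ i, ((Uᴴ * A * U) i i).re = ((Uᴴ * B * U) i i).re
  · have hle := Finset.sum_le_sum hterm
    rw [hsplit, ← hdiag] at hle
    refine lt_of_le_of_ne (by linarith) fun hcontra => hne ?_
    have e : Uᴴ * A * U = Uᴴ * B * U := by
      rw [hA2 (by linarith), hB2 (by linarith)]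
      simp_rw [heq]
    have e2 := congrArg (fun X => U * X * Uᴴ) e
    have hc : ∀ X : Matrix n n ℂ, U * (Uᴴ * X * U) * Uᴴ = X := fun X => by
      calc _ = (U * Uᴴ) * X * (U * Uᴴ) := by simp only [mul_assoc]
        _ = _ := by rw [hU', one_mul, mul_one]
    simpa only [hc] using e2
  · push Not at heq
    obtain ⟨i, hi⟩ := heq
    have hlt := Finset.sum_lt_sum hterm ⟨i, Finset.mem_univ i,
      Real.strictConcaveOn_negMulLog.2 (hnn hA i) (hnn hB i) hi
        (by norm_num) (by norm_num) (by norm_num)⟩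
    rw [hsplit, ← hdiag] at hlt
    linarith

end Entropy

/-! ### Permutation symmetry of the measurement probabilities -/

section Permutations

variable {N : ℕ}

lemma permOp_mul (p q : Equiv.Perm (Fin N)) : permOp p * permOp q = permOp (p * q) := by
  ext x z
  simp only [permOp, mul_apply, of_apply, mul_ite, mul_one, mul_zero, _root_.mul_inv_rev,
    Equiv.Perm.mul_apply]
  rw [Finset.sum_ite_eq' Finset.univ (fun n => z (q⁻¹ n)) fun y =>
    if x = fun n => y (p⁻¹ n) then (1 : ℂ) else 0]
  simp

lemma permOp_one : permOp (1 : Equiv.Perm (Fin N)) = 1 := by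
  ext x y
  simp [permOp, one_apply]

lemma conjTranspose_permOp (p : Equiv.Perm (Fin N)) : (permOp p)ᴴ = permOp p⁻¹ := by
  ext x y
  have : (y = fun n => x (p⁻¹ n)) ↔ x = fun n => y (p n) := by
    constructor
    · rintro rfl; simp
    · rintro rfl; simp
  simp only [permOp, conjTranspose_apply, of_apply, this, inv_inv]
  split_ifs <;> simp

lemma permOp_mem_unitaryGroup (p : Equiv.Perm (Fin N)) :
    permOp p ∈ unitaryGroup (QubitIdx N) ℂ := by
  rw [mem_unitaryGroup_iff, star_eq_conjTranspose, conjTranspose_permOp, permOp_mul,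
    mul_inv_cancel, permOp_one]

lemma isPermInvariant_piPart (A : Op N) : IsPermInvariant (piPart A) := by
  intro q
  have hsum : ∑ p : Equiv.Perm (Fin N), permOp q * (permOp p * A * (permOp p)ᴴ) * (permOp q)ᴴ =
      ∑ p : Equiv.Perm (Fin N), permOp p * A * (permOp p)ᴴ := by
    refine Fintype.sum_equiv (Equiv.mulLeft q) _ _ fun p => ?_
    rw [Equiv.coe_mulLeft, ← permOp_mul, conjTranspose_mul]
    simp only [mul_assoc]
  rw [piPart, Matrix.mul_smul, Matrix.smul_mul, Finset.mul_sum, Finset.sum_mul, hsum]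

lemma trace_permOp_conj (p : Equiv.Perm (Fin N)) (A : Op N) :
    (permOp p * A * (permOp p)ᴴ).trace = A.trace := by
  rw [trace_mul_comm, ← mul_assoc, conjTranspose_permOp, permOp_mul, inv_mul_cancel, permOp_one,
    one_mul]

lemma inv_factorial_smul_sum_const {M : Type*} [AddCommGroup M] [Module ℂ M] (c : M) :
    ((N.factorial : ℂ)⁻¹) • ∑ _p : Equiv.Perm (Fin N), c = c := by
  rw [Finset.sum_const, Finset.card_univ, Fintype.card_perm, Fintype.card_fin,
    ← Nat.cast_smul_eq_nsmul ℂ, smul_smul, inv_mul_cancel₀ (by exact_mod_cast N.factorial_ne_zero),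
    one_smul]

lemma trace_piPart (A : Op N) : (piPart A).trace = A.trace := by
  rw [piPart, trace_smul, trace_sum]
  simp_rw [trace_permOp_conj]
  exact inv_factorial_smul_sum_const _

lemma IsDensity.permOp_conj {ρ : Op N} (h : IsDensity ρ) (p : Equiv.Perm (Fin N)) :
    IsDensity (permOp p * ρ * (permOp p)ᴴ) :=
  ⟨h.1.mul_mul_conjTranspose_same _, (trace_permOp_conj p ρ).trans h.2⟩

lemma IsDensity.piPart {ρ : Op N} (h : IsDensity ρ) : IsDensity (piPart ρ) := by
  refine ⟨?_, (trace_piPart ρ).trans h.2⟩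
  refine (posSemidef_sum _ fun p _ => (h.permOp_conj p).1).smul ?_
  rw [← Complex.ofReal_natCast, ← Complex.ofReal_inv]
  exact Complex.zero_le_real.mpr (by positivity)

lemma IsPermInvariant.measOp (a : EuclideanSpace ℝ (Fin 3)) (k : Fin (N + 1)) :
    IsPermInvariant (measOp N a k) := by
  intro p
  rw [PITomography.measOp, Matrix.mul_smul, Matrix.smul_mul, isPermInvariant_piPart]

/-- Cyclicity of the trace moves the conjugation onto `M`, which absorbs it. -/
lemma trace_permOp_conj_mul {M : Op N} (hM : IsPermInvariant M) (p : Equiv.Perm (Fin N))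
    (A : Op N) : (permOp p * A * (permOp p)ᴴ * M).trace = (A * M).trace := by
  conv_rhs => rw [← hM p⁻¹, conjTranspose_permOp, inv_inv, ← mul_assoc, trace_mul_comm]
  rw [conjTranspose_permOp]
  simp only [mul_assoc]

lemma prob_permOp_conj (a : EuclideanSpace ℝ (Fin 3)) (k : Fin (N + 1)) (p : Equiv.Perm (Fin N))
    (ρ : Op N) : prob a k (permOp p * ρ * (permOp p)ᴴ) = prob a k ρ := by
  rw [prob, trace_permOp_conj_mul (IsPermInvariant.measOp a k), prob]

lemma prob_piPart (a : EuclideanSpace ℝ (Fin 3)) (k : Fin (N + 1)) (ρ : Op N) :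
    prob a k (piPart ρ) = prob a k ρ := by
  rw [prob, piPart, Matrix.smul_mul, trace_smul, Finset.sum_mul, trace_sum]
  simp_rw [trace_permOp_conj_mul (IsPermInvariant.measOp a k)]
  rw [inv_factorial_smul_sum_const, prob]

lemma prob_midpoint (a : EuclideanSpace ℝ (Fin 3)) (k : Fin (N + 1)) (ρ σ : Op N) :
    prob a k ((2 : ℂ)⁻¹ • (ρ + σ)) = (prob a k ρ + prob a k σ) / 2 := by
  have : (2 : ℂ)⁻¹ = ((1 / 2 : ℝ) : ℂ) := by norm_num
  rw [prob, this, Matrix.smul_mul, trace_smul, add_mul, trace_add, smul_eq_mul,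
    Complex.re_ofReal_mul, Complex.add_re, prob, prob]
  ring

lemma continuous_prob (a : EuclideanSpace ℝ (Fin 3)) (k : Fin (N + 1)) :
    Continuous (prob (N := N) a k) := by
  unfold prob
  fun_prop

lemma trace_tensorOp (A : Fin N → Matrix (Fin 2) (Fin 2) ℂ) :
    (tensorOp A).trace = ∏ n, (A n).trace := by
  simp only [trace, diag_apply, tensorOp, of_apply]
  exact (Fintype.prod_sum fun n i => A n i i).symm

lemma trace_eigenProj (a : EuclideanSpace ℝ (Fin 3)) (b : Fin 2) : (eigenProj a b).trace = 1 := by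
  simp [eigenProj, pauliDot, trace_fin_two]

lemma trace_measOp (a : EuclideanSpace ℝ (Fin 3)) (k : Fin (N + 1)) :
    (measOp N a k).trace = N.choose k := by
  rw [measOp, trace_smul, trace_piPart, trace_tensorOp, Finset.prod_eq_one, smul_eq_mul, mul_one]
  intro n _
  split_ifs <;> exact trace_eigenProj _ _

/-- The completely mixed state. -/
def mixedState (N : ℕ) : Op N := ((2 : ℂ) ^ N)⁻¹ • 1

lemma isDensity_mixedState : IsDensity (mixedState N) := by
  refine ⟨PosSemidef.one.smul ?_, ?_⟩
  · have : ((2 : ℂ) ^ N)⁻¹ = (((2 : ℝ) ^ N)⁻¹ : ℝ) := by push_cast; rfl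
    rw [this]
    exact Complex.zero_le_real.mpr (by positivity)
  · rw [mixedState, trace_smul, trace_one]
    simp

lemma isPermInvariant_mixedState : IsPermInvariant (mixedState N) := by
  intro p
  rw [mixedState, Matrix.mul_smul, Matrix.smul_mul, mul_one, conjTranspose_permOp, permOp_mul,
    mul_inv_cancel, permOp_one]

/-- Each eigenprojector has trace 1, so the value is `N.choose k / 2 ^ N`. This makes the maximal
likelihood positive. -/
lemma prob_mixedState_pos (a : EuclideanSpace ℝ (Fin 3)) (k : Fin (N + 1)) :
    0 < prob a k (mixedState N) := by
  have h : prob a k (mixedState N) = ((2 : ℝ) ^ N)⁻¹ * N.choose k := by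
    rw [prob, mixedState, Matrix.smul_mul, one_mul, trace_smul, trace_measOp, smul_eq_mul]
    have : ((2 : ℂ) ^ N)⁻¹ * N.choose k = (((2 : ℝ) ^ N)⁻¹ * N.choose k : ℝ) := by push_cast; rfl
    rw [this, Complex.ofReal_re]
  rw [h]
  have := Nat.choose_pos (Nat.lt_succ_iff.mp k.2)
  positivity

lemma isClosed_isPermInvariant : IsClosed {ρ : Op N | IsPermInvariant ρ} := by
  have h : {ρ : Op N | IsPermInvariant ρ} =
      ⋂ p : Equiv.Perm (Fin N), {ρ | permOp p * ρ * (permOp p)ᴴ = ρ} := by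
    ext ρ
    simp [IsPermInvariant]
  rw [h]
  refine isClosed_iInter fun p => isClosed_eq ?_ continuous_id
  exact (continuous_const.matrix_mul continuous_id).matrix_mul continuous_const

end Permutations

/-! ### Likelihood, its maximizers, and entropy among them -/

section Likelihood

variable {N : ℕ} {ι : Type*} [Fintype ι]

/-- The likelihood `∏ p_k^a(ρ) ^ f_k^a`, whose negative logarithm is the fit function. -/
def likelihood (a : ι → EuclideanSpace ℝ (Fin 3)) (f : ι → Fin (N + 1) → ℝ) (ρ : Op N) : ℝ :=
  -- Truncation at 0 matches `ENNReal.ofReal` in `fitML`, and `0 ^ 0 = 1` matches `0 * log 0 = 0`.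
  ∏ i, ∏ k, (max (prob (a i) k ρ) 0) ^ f i k

variable {a : ι → EuclideanSpace ℝ (Fin 3)} {f : ι → Fin (N + 1) → ℝ}

lemma likelihood_nonneg (ρ : Op N) : 0 ≤ likelihood a f ρ :=
  Finset.prod_nonneg fun _ _ => Finset.prod_nonneg fun _ _ =>
    Real.rpow_nonneg (le_max_right _ _) _

lemma continuous_likelihood (hf : ∀ i k, 0 ≤ f i k) : Continuous (likelihood (N := N) a f) := by
  unfold likelihood
  refine continuous_finsetProd _ fun i _ => continuous_finsetProd _ fun k _ => ?_
  exact ((continuous_prob (a i) k).max continuous_const).rpow_const fun _ => Or.inr (hf i k)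

lemma log_prod_eq_sum {κ : Type*} (s : Finset κ) (g : κ → ENNReal) :
    ENNReal.log (∏ i ∈ s, g i) = ∑ i ∈ s, ENNReal.log (g i) := by
  classical
  induction s using Finset.induction_on with
  | empty => simp
  | insert i s hi ih => rw [Finset.prod_insert hi, Finset.sum_insert hi, ENNReal.log_mul_add, ih]

/-- Negation in `EReal` fails to distribute over `⊤ + ⊥`; finiteness of the factors rules this case
out. -/
lemma sum_neg_log {κ : Type*} (s : Finset κ) (g : κ → ENNReal) (hg : ∀ i ∈ s, g i ≠ ⊤) :
    ∑ i ∈ s, -ENNReal.log (g i) = -ENNReal.log (∏ i ∈ s, g i) := by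
  simp_rw [← ENNReal.log_inv]
  rw [← log_prod_eq_sum, ENNReal.prod_inv_distrib]
  exact fun i hi j hj _ => Or.inr (hg j hj)

lemma fitML_eq_neg_log (hf : ∀ i k, 0 ≤ f i k) (ρ : Op N) :
    fitML a f ρ = -ENNReal.log (ENNReal.ofReal (likelihood a f ρ)) := by
  have hterm : ∀ i k, -((f i k : EReal) * ENNReal.log (ENNReal.ofReal (prob (a i) k ρ))) =
      -ENNReal.log (ENNReal.ofReal ((max (prob (a i) k ρ) 0) ^ f i k)) := by
    intro i k
    rw [← ENNReal.log_rpow, ← ENNReal.ofReal_rpow_of_nonneg (le_max_right _ _) (hf i k)]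
    congr 3
    rcases le_total (prob (a i) k ρ) 0 with h | h
    · rw [max_eq_right h, ENNReal.ofReal_of_nonpos h, ENNReal.ofReal_zero]
    · rw [max_eq_left h]
  have hnn : ∀ i k, 0 ≤ (max (prob (a i) k ρ) 0) ^ f i k := fun i k =>
    Real.rpow_nonneg (le_max_right _ _) _
  simp_rw [fitML, hterm]
  have hinner : ∀ i, ∑ k, -ENNReal.log (ENNReal.ofReal ((max (prob (a i) k ρ) 0) ^ f i k)) =
      -ENNReal.log (ENNReal.ofReal (∏ k, (max (prob (a i) k ρ) 0) ^ f i k)) := fun i => by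
    rw [sum_neg_log _ _ fun _ _ => ENNReal.ofReal_ne_top,
      ENNReal.ofReal_prod_of_nonneg fun k _ => hnn i k]
  simp_rw [hinner]
  rw [sum_neg_log _ _ fun _ _ => ENNReal.ofReal_ne_top, likelihood,
    ENNReal.ofReal_prod_of_nonneg fun i _ => Finset.prod_nonneg fun k _ => hnn i k]

lemma fitML_le_fitML_iff (hf : ∀ i k, 0 ≤ f i k) (ρ σ : Op N) :
    fitML a f ρ ≤ fitML a f σ ↔ likelihood a f σ ≤ likelihood a f ρ := by
  rw [fitML_eq_neg_log hf, fitML_eq_neg_log hf, EReal.neg_le_neg_iff, ENNReal.log_le_log_iff,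
    ENNReal.ofReal_le_ofReal_iff (likelihood_nonneg ρ)]

lemma likelihood_mixedState_pos : 0 < likelihood a f (mixedState N) :=
  Finset.prod_pos fun i _ => Finset.prod_pos fun k _ =>
    Real.rpow_pos_of_pos (lt_max_of_lt_left (prob_mixedState_pos (a i) k)) _

lemma prob_pos_of_likelihood_pos {ρ : Op N} (h : 0 < likelihood a f ρ) {i : ι} {k : Fin (N + 1)}
    (hik : 0 < f i k) : 0 < prob (a i) k ρ := by
  by_contra hp
  refine h.ne' (Finset.prod_eq_zero (Finset.mem_univ i)
    (Finset.prod_eq_zero (Finset.mem_univ k) ?_))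
  rw [max_eq_right (not_lt.mp hp), Real.zero_rpow hik.ne']

lemma likelihood_congr (hf : ∀ i k, 0 ≤ f i k) {ρ σ : Op N}
    (h : ∀ i k, 0 < f i k → prob (a i) k ρ = prob (a i) k σ) :
    likelihood a f ρ = likelihood a f σ := by
  refine Finset.prod_congr rfl fun i _ => Finset.prod_congr rfl fun k _ => ?_
  rcases (hf i k).eq_or_lt with h0 | h0
  · rw [← h0, Real.rpow_zero, Real.rpow_zero]
  · rw [h i k h0]

/-- The likelihood is strictly logarithmically concave in the observed probabilities. -/
lemma prob_eq_of_likelihood_midpoint_le (hf : ∀ i k, 0 ≤ f i k) {ρ σ : Op N}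
    (hρ : 0 < likelihood a f ρ) (hσ : 0 < likelihood a f σ)
    (hle : likelihood a f ((2 : ℂ)⁻¹ • (ρ + σ)) ^ 2 ≤ likelihood a f ρ * likelihood a f σ)
    {i : ι} {k : Fin (N + 1)} (hik : 0 < f i k) : prob (a i) k ρ = prob (a i) k σ := by
  by_contra hne
  refine hle.not_gt ?_
  set P : ι × Fin (N + 1) → Op N → ℝ := fun x τ => max (prob (a x.1) x.2 τ) 0
  have hprod : ∀ τ, likelihood a f τ = ∏ x : ι × Fin (N + 1), P x τ ^ f x.1 x.2 := fun τ =>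
    (Fintype.prod_prod_type fun x : ι × Fin (N + 1) => P x τ ^ f x.1 x.2).symm
  have hP0 : ∀ x τ, 0 ≤ P x τ := fun x τ => le_max_right _ _
  have hpos : ∀ x : ι × Fin (N + 1), 0 < f x.1 x.2 → 0 < prob (a x.1) x.2 ρ ∧
      0 < prob (a x.1) x.2 σ ∧ P x ρ = prob (a x.1) x.2 ρ ∧ P x σ = prob (a x.1) x.2 σ ∧
      P x ((2 : ℂ)⁻¹ • (ρ + σ)) = (prob (a x.1) x.2 ρ + prob (a x.1) x.2 σ) / 2 := by
    intro x hx
    have h1 := prob_pos_of_likelihood_pos hρ hx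
    have h2 := prob_pos_of_likelihood_pos hσ hx
    refine ⟨h1, h2, max_eq_left h1.le, max_eq_left h2.le, ?_⟩
    simp only [P, prob_midpoint]
    exact max_eq_left (by linarith)
  rw [hprod, hprod, hprod, ← Finset.prod_mul_distrib, ← Finset.prod_pow]
  have hl : ∀ x : ι × Fin (N + 1), P x ρ ^ f x.1 x.2 * P x σ ^ f x.1 x.2 =
      (P x ρ * P x σ) ^ f x.1 x.2 := fun x => (Real.mul_rpow (hP0 _ _) (hP0 _ _)).symm
  have hr : ∀ x : ι × Fin (N + 1), (P x ((2 : ℂ)⁻¹ • (ρ + σ)) ^ f x.1 x.2) ^ 2 =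
      (P x ((2 : ℂ)⁻¹ • (ρ + σ)) ^ 2) ^ f x.1 x.2 := fun x =>
    (Real.rpow_pow_comm (hP0 _ _) _ _)
  simp_rw [hl, hr]
  -- Factorwise this is `x * y ≤ ((x + y) / 2) ^ 2`, strict at `(i, k)`. Unobserved factors equal 1,
  -- so every factor on the left is positive.
  refine Finset.prod_lt_prod (fun x _ => ?_) (fun x _ => ?_) ⟨(i, k), Finset.mem_univ _, ?_⟩
  · rcases (hf x.1 x.2).eq_or_lt with h0 | h0
    · rw [← h0, Real.rpow_zero]; exact one_pos
    · obtain ⟨h1, h2, e1, e2, -⟩ := hpos x h0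
      rw [e1, e2]
      exact Real.rpow_pos_of_pos (mul_pos h1 h2) _
  · rcases (hf x.1 x.2).eq_or_lt with h0 | h0
    · rw [← h0, Real.rpow_zero, Real.rpow_zero]
    · obtain ⟨h1, h2, e1, e2, e3⟩ := hpos x h0
      rw [e1, e2, e3]
      refine Real.rpow_le_rpow (mul_pos h1 h2).le ?_ h0.le
      nlinarith [sq_nonneg (prob (a x.1) x.2 ρ - prob (a x.1) x.2 σ)]
  · obtain ⟨h1, h2, e1, e2, e3⟩ := hpos (i, k) hik
    rw [e1, e2, e3]
    refine Real.rpow_lt_rpow (mul_pos h1 h2).le ?_ hik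
    nlinarith [sq_pos_of_ne_zero (sub_ne_zero.mpr hne)]

lemma IsDensity.midpoint {ρ σ : Op N} (hρ : IsDensity ρ) (hσ : IsDensity σ) :
    IsDensity ((2 : ℂ)⁻¹ • (ρ + σ)) := by
  refine ⟨posSemidef_midpoint hρ.1 hσ.1, ?_⟩
  rw [trace_smul, trace_add, hρ.2, hσ.2]
  norm_num

lemma exists_isPIReconstruction (hf : ∀ i k, 0 ≤ f i k) :
    ∃ ρ : Op N, IsPIReconstruction a f ρ := by
  have hK : IsCompact {ρ : Op N | IsDensity ρ ∧ IsPermInvariant ρ} :=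
    (isCompact_density (n := QubitIdx N)).inter_right isClosed_isPermInvariant
  obtain ⟨ρ, hρ, hmax⟩ := hK.exists_isMaxOn
    ⟨mixedState N, isDensity_mixedState, isPermInvariant_mixedState⟩
    (continuous_likelihood (a := a) hf).continuousOn
  exact ⟨ρ, hρ.1, hρ.2, fun σ h1 h2 => (fitML_le_fitML_iff hf ρ σ).mpr (hmax ⟨h1, h2⟩)⟩

lemma IsPIReconstruction.isMaxLik {ρ : Op N}
    (h : IsPIReconstruction a f ρ) : IsMaxLik a f ρ := by
  refine ⟨h.1, fun σ hσ => (h.2.2 _ hσ.piPart (isPermInvariant_piPart σ)).trans_eq ?_⟩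
  rw [fitML, fitML]
  simp_rw [prob_piPart]

lemma IsMaxLik.isPIReconstruction {ρ : Op N} (h : IsMaxLik a f ρ) (hρ : IsPermInvariant ρ) :
    IsPIReconstruction a f ρ :=
  ⟨h.1, hρ, fun σ hσ _ => h.2 σ hσ⟩

lemma IsMaxLik.permOp_conj {ρ : Op N} (h : IsMaxLik a f ρ) (p : Equiv.Perm (Fin N)) :
    IsMaxLik a f (permOp p * ρ * (permOp p)ᴴ) := by
  refine ⟨h.1.permOp_conj p, fun σ hσ => le_of_eq_of_le ?_ (h.2 σ hσ)⟩
  rw [fitML, fitML]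
  simp_rw [prob_permOp_conj]

lemma IsMaxLik.likelihood_pos (hf : ∀ i k, 0 ≤ f i k) {ρ : Op N} (h : IsMaxLik a f ρ) :
    0 < likelihood a f ρ :=
  likelihood_mixedState_pos.trans_le
    ((fitML_le_fitML_iff hf _ _).mp (h.2 _ isDensity_mixedState))

/-- All maximum-likelihood states assign the same probabilities to the observed outcomes. -/
lemma IsMaxLik.prob_eq (hf : ∀ i k, 0 ≤ f i k) {ρ σ : Op N} (hρ : IsMaxLik a f ρ)
    (hσ : IsMaxLik a f σ) {i : ι} {k : Fin (N + 1)} (hik : 0 < f i k) :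
    prob (a i) k ρ = prob (a i) k σ := by
  refine prob_eq_of_likelihood_midpoint_le hf (hρ.likelihood_pos hf) (hσ.likelihood_pos hf) ?_ hik
  have hτ := hρ.1.midpoint hσ.1
  rw [sq]
  exact mul_le_mul ((fitML_le_fitML_iff hf _ _).mp (hρ.2 _ hτ))
    ((fitML_le_fitML_iff hf _ _).mp (hσ.2 _ hτ)) (likelihood_nonneg _) (likelihood_nonneg _)

/-- With `IsMaxLik.prob_eq`, this shows that the maximum-likelihood states are the densities with
prescribed observed probabilities. -/
lemma IsMaxLik.of_prob_eq (hf : ∀ i k, 0 ≤ f i k) {ρ σ : Op N} (hρ : IsMaxLik a f ρ)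
    (hσ : IsDensity σ) (h : ∀ i k, 0 < f i k → prob (a i) k σ = prob (a i) k ρ) :
    IsMaxLik a f σ := by
  refine ⟨hσ, fun τ hτ => ?_⟩
  rw [fitML_le_fitML_iff hf, likelihood_congr hf h]
  exact (fitML_le_fitML_iff hf _ _).mp (hρ.2 τ hτ)

lemma IsMaxLik.midpoint (hf : ∀ i k, 0 ≤ f i k) {ρ σ : Op N} (hρ : IsMaxLik a f ρ)
    (hσ : IsMaxLik a f σ) : IsMaxLik a f ((2 : ℂ)⁻¹ • (ρ + σ)) := by
  refine hρ.of_prob_eq hf (hρ.1.midpoint hσ.1) fun i k hik => ?_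
  rw [prob_midpoint, hρ.prob_eq hf hσ hik]
  ring

lemma isCompact_isMaxLik (hf : ∀ i k, 0 ≤ f i k) : IsCompact {ρ : Op N | IsMaxLik a f ρ} := by
  have : {ρ : Op N | IsMaxLik a f ρ} = {ρ | IsDensity ρ} ∩
      ⋂ σ ∈ {σ : Op N | IsDensity σ}, {ρ | likelihood a f σ ≤ likelihood a f ρ} := by
    ext ρ
    simp [IsMaxLik, fitML_le_fitML_iff hf]
  rw [this]
  exact (isCompact_density (n := QubitIdx N)).inter_right <| isClosed_biInter fun σ _ =>
    isClosed_le continuous_const (continuous_likelihood hf)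

lemma exists_isMaxLikMaxEnt (hf : ∀ i k, 0 ≤ f i k) : ∃ ρ : Op N, IsMaxLikMaxEnt a f ρ := by
  obtain ⟨ρ₀, hρ₀⟩ := exists_isPIReconstruction (N := N) (a := a) hf
  obtain ⟨ρ, hρ, hmax⟩ := UpperSemicontinuousOn.exists_isMaxOn ⟨ρ₀, hρ₀.isMaxLik⟩
    (isCompact_isMaxLik (N := N) (a := a) hf)
    ((upperSemicontinuousOn_trace_cfc (n := QubitIdx N)).mono fun ρ hρ => hρ.1.1)
  exact ⟨ρ, hρ, fun σ hσ => hmax hσ⟩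

lemma IsMaxLikMaxEnt.eq (hf : ∀ i k, 0 ≤ f i k) {ρ σ : Op N} (hρ : IsMaxLikMaxEnt a f ρ)
    (hσ : IsMaxLikMaxEnt a f σ) : ρ = σ := by
  by_contra hne
  have hlt := trace_cfc_midpoint_lt hρ.1.1.1 hσ.1.1.1 hne
  have h1 := hρ.2 _ (hρ.1.midpoint hf hσ.1)
  have h2 := hσ.2 _ (hρ.1.midpoint hf hσ.1)
  unfold vonNeumannEntropy at h1 h2
  linarith

/-- A permuted solution has the same fit and entropy, so uniqueness forces it to coincide with the
original. -/
lemma IsMaxLikMaxEnt.isPermInvariant (hf : ∀ i k, 0 ≤ f i k) {ρ : Op N}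
    (hρ : IsMaxLikMaxEnt a f ρ) : IsPermInvariant ρ := by
  intro p
  refine IsMaxLikMaxEnt.eq (a := a) hf ⟨hρ.1.permOp_conj p, fun σ hσ => (hρ.2 σ hσ).trans_eq ?_⟩ hρ
  exact (trace_cfc_conj hρ.1.1.1 (permOp_mem_unitaryGroup p)).symm

lemma existsUnique_isPIReconstruction (hf : ∀ i k, 0 ≤ f i k)
    (h : TomographicallyComplete (N := N) a {x | 0 < f x.1 x.2}) :
    ∃! ρ : Op N, IsPIReconstruction a f ρ := by
  obtain ⟨ρ, hρ⟩ := exists_isPIReconstruction (N := N) (a := a) hf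
  refine ⟨ρ, hρ, fun σ hσ => h σ ρ hσ.1 hσ.2.1 hρ.1 hρ.2.1 fun x hx => ?_⟩
  exact (hσ.isMaxLik).prob_eq hf (hρ.isMaxLik) hx

end Likelihood

end PITomography

end

theorem mainTheorem3 {N : ℕ} {ι : Type*} [Fintype ι]
    (a : ι → EuclideanSpace ℝ (Fin 3)) (ha : ∀ i, ‖a i‖ = 1)
    (hcomplete : PITomography.TomographicallyComplete (N := N) a Set.univ)
    (f : ι → Fin (N + 1) → ℝ) (hf : ∀ i k, 0 ≤ f i k) :
    -- the reconstruction and the MaxLik-MaxEnt problem are solvable, the latter uniquely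
    (∃ ρ : PITomography.Op N, PITomography.IsPIReconstruction a f ρ) ∧
    (∃! ρ : PITomography.Op N, PITomography.IsMaxLikMaxEnt a f ρ) ∧
    -- reconstructed states are maximum-likelihood states among all states
    (∀ ρ : PITomography.Op N,
      PITomography.IsPIReconstruction a f ρ → PITomography.IsMaxLik a f ρ) ∧
    -- the reconstructed state, when unique, is exactly the MaxLik-MaxEnt solution
    ((∃! ρ : PITomography.Op N, PITomography.IsPIReconstruction a f ρ) →
      ∀ ρ : PITomography.Op N,
        PITomography.IsPIReconstruction a f ρ ↔ PITomography.IsMaxLikMaxEnt a f ρ) ∧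
    -- it is unique if the outcomes that were observed are tomographically complete
    (PITomography.TomographicallyComplete (N := N) a {x | 0 < f x.1 x.2} →
      ∃! ρ : PITomography.Op N, PITomography.IsPIReconstruction a f ρ) ∧
    -- in particular if every outcome was observed
    ((∀ i k, 0 < f i k) →
      ∃! ρ : PITomography.Op N, PITomography.IsPIReconstruction a f ρ) ∧
    -- without uniqueness: the solution is the reconstructed state of largest entropy
    (∀ ρ : PITomography.Op N,
      PITomography.IsMaxLikMaxEnt a f ρ ↔
        PITomography.IsPIReconstruction a f ρ ∧
          ∀ σ : PITomography.Op N, PITomography.IsPIReconstruction a f σ →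
            PITomography.vonNeumannEntropy σ ≤ PITomography.vonNeumannEntropy ρ) := by

  obtain ⟨m, hm⟩ := PITomography.exists_isMaxLikMaxEnt (N := N) (a := a) hf
  -- The MaxLik-MaxEnt solution is itself a reconstruction; both entropy characterizations compare
  -- with it.
  have hmPI := hm.1.isPIReconstruction (hm.isPermInvariant hf)
  refine ⟨PITomography.exists_isPIReconstruction hf, ⟨m, hm, fun σ hσ => hσ.eq hf hm⟩,
    fun ρ hρ => hρ.isMaxLik, fun huniq ρ => ⟨fun hρ => ?_, fun hρ => ?_⟩,
    PITomography.existsUnique_isPIReconstruction hf, fun hpos => ?_,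
    fun ρ => ⟨fun hρ => ?_, fun hρ => ?_⟩⟩
  · exact huniq.unique hmPI hρ ▸ hm
  · exact hρ.1.isPIReconstruction (hρ.isPermInvariant hf)
  · refine PITomography.existsUnique_isPIReconstruction hf ?_
    have huniv : {x : ι × Fin (N + 1) | 0 < f x.1 x.2} = Set.univ :=
      Set.eq_univ_of_forall fun x => hpos x.1 x.2
    rwa [huniv]
  · exact ⟨hρ.1.isPIReconstruction (hρ.isPermInvariant hf), fun σ hσ => hρ.2 σ (hσ.isMaxLik)⟩
  -- Since `m` is among the reconstructions, the entropy of `ρ` is at least that of `m`, which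
  -- bounds all the others.
  · exact ⟨hρ.1.isMaxLik, fun σ hσ => (hm.2 σ hσ).trans (hρ.2 m hmPI)⟩
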